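/- For $c\in\mathbb C$ and $k\in\mathbb Z_{\ge0}$ put $(c)_k=c(c+1)\cdots(c+k-1)$. The Meixner–Pollaczek polynomials are $$P_n^{(\lambda)}(x;\phi)=\frac{(2\lambda)_n}{n!}\,e^{in\phi}\;{}_2F_1\!\left({-n,\ \lambda+ix\atop 2\lambda};1-e^{-2i\phi}\right),$$ and the continuous dual Hahn polynomials are the polynomials $S_n(\,\cdot\,;a,b,c)$ of degree $n$ in $x^2$ given by $$S_n(x^2;a,b,c)=(a+b)_n(a+c)_n\;{}_3F_2\!\left({-n,\ a+ix,\ a-ix\atop a+b,\ a+c};1\right).$$ Let $a\in\mathbb C$ with $2a\notin\{0,-1,-2,\ldots\}$ (for instance $a>0$), and let $n\in\mathbb Z_{\ge0}$. Then the numbers $P_{2n}^{(a)}(ia;\tfrac\pi2)$, $P_{2n+1}^{(a)}(ia;\tfrac\pi2)$, $S_n(-a^2;a,\tfrac12,0)$ and $ia\,S_n(-a^2;a,\tfrac12,1)$ are nonzero, and for all $x\in\mathbb C$ $$\frac{P_{2n}^{(a)}(x;\tfrac\pi2)}{P_{2n}^{(a)}(ia;\tfrac\pi2)}=\frac{S_n(x^2;a,\tfrac12,0)}{S_n(-a^2;a,\tfrac12,0)},\qquad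 \frac{P_{2n+1}^{(a)}(x;\tfrac\pi2)}{P_{2n+1}^{(a)}(ia;\tfrac\pi2)}=\frac{x\,S_n(x^2;a,\tfrac12,1)}{ia\,S_n(-a^2;a,\tfrac12,1)}.$$ Moreover, the left-hand and right-hand sides of these two formulas are equal, respectively, to the left-hand and right-hand sides of the terminating hypergeometric identities $${}_2F_1\!\left({-2n,\ a+ix\atop 2a};2\right)={}_3F_2\!\left({-n,\ a+ix,\ a-ix\atop a+\frac12,\ a};1\right),$$ $${}_2F_1\!\left({-2n-1,\ a+ix\atop 2a};2\right)=\frac{x}{ia}\;{}_3F_2\!\left({-n,\ a+ix,\ a-ix\atop a+\frac12,\ a+1};1\right),$$ which therefore hold as well. -/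

import Mathlib

open Polynomial

noncomputable section

/-- The Pochhammer symbol (shifted factorial) `(c)_k = c (c+1) ⋯ (c+k-1)`. -/
def poch (c : ℂ) (k : ℕ) : ℂ := (ascPochhammer ℂ k).eval c

/-- The hypergeometric series `₃F₂(a₁, a₂, a₃; b₁, b₂; z)`. -/
def hyp32 (a₁ a₂ a₃ b₁ b₂ z : ℂ) : ℂ :=
  ∑' k : ℕ, poch a₁ k * poch a₂ k * poch a₃ k / (poch b₁ k * poch b₂ k * (k.factorial : ℂ)) * z ^ k

/-- The Meixner–Pollaczek polynomial `P_n^{(lam)}(X; φ)`, that is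
`(2 lam)_n / n! · e^{i n φ} · ₂F₁(-n, lam + i X; 2 lam; 1 - e^{-2 i φ})`,
where `(lam + i X)_k = ∏_{j < k} (lam + j + i X)`. -/
def meixnerPollaczek (n : ℕ) (lam : ℂ) (φ : ℝ) : ℂ[X] :=
  C (poch (2 * lam) n / (n.factorial : ℂ) * Complex.exp (Complex.I * n * φ)) *
    ∑ k ∈ Finset.range (n + 1),
      C (poch (-(n : ℂ)) k / (poch (2 * lam) k * (k.factorial : ℂ)) *
          (1 - Complex.exp (-(2 * Complex.I * φ))) ^ k) *
        ∏ j ∈ Finset.range k, (C (lam + j) + C Complex.I * X)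

/-- The continuous dual Hahn polynomial `S_n(Y; a, b, c)` in the variable `Y = x²`, that is
`(a+b)_n (a+c)_n · ₃F₂(-n, a + i x, a - i x; a + b, a + c; 1)`,
where `(a + i x)_k (a - i x)_k = ∏_{j < k} ((a + j)² + x²)`. -/
def continuousDualHahn (n : ℕ) (a b c : ℂ) : ℂ[X] :=
  C (poch (a + b) n * poch (a + c) n) *
    ∑ k ∈ Finset.range (n + 1),
      C (poch (-(n : ℂ)) k / (poch (a + b) k * poch (a + c) k * (k.factorial : ℂ))) *
        ∏ j ∈ Finset.range k, (C ((a + j) ^ 2) + X)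

theorem poch_eq_prod (c : ℂ) (k : ℕ) : poch c k = ∏ j ∈ Finset.range k, (c + j) := by
  rw [poch]
  induction k with
  | zero => simp
  | succ k ih => rw [ascPochhammer_succ_eval, ih, Finset.prod_range_succ]

theorem poch_neg_eq_zero {n k : ℕ} (h : n < k) : poch (-(n : ℂ)) k = 0 := by
  rw [poch_eq_prod]
  exact Finset.prod_eq_zero (Finset.mem_range.2 h) (by simp)

theorem meixnerPollaczek_eval (n : ℕ) (lam : ℂ) (φ : ℝ) (x : ℂ) :
    (meixnerPollaczek n lam φ).eval x =
      poch (2 * lam) n / (n.factorial : ℂ) * Complex.exp (Complex.I * n * φ) *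
        ordinaryHypergeometric (-(n : ℂ)) (lam + Complex.I * x) (2 * lam)
          (1 - Complex.exp (-(2 * Complex.I * φ))) := by
  rw [ordinaryHypergeometric_eq_tsum]
  simp only [meixnerPollaczek, eval_mul, eval_C, eval_finsetSum, eval_prod, eval_add, eval_X]
  congr 1
  rw [tsum_eq_sum (s := Finset.range (n + 1))]
  · refine Finset.sum_congr rfl fun k _ => ?_
    have h : ∏ j ∈ Finset.range k, (lam + j + Complex.I * x) = poch (lam + Complex.I * x) k := by
      rw [poch_eq_prod]
      exact Finset.prod_congr rfl fun j _ => by ring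
    rw [h]
    simp only [poch, smul_eq_mul, div_eq_mul_inv, mul_inv]
    ring
  · intro k hk
    have h := poch_neg_eq_zero (n := n) (k := k) (by simpa using hk)
    rw [poch] at h
    simp [h]

theorem continuousDualHahn_eval_sq (n : ℕ) (a b c x : ℂ) :
    (continuousDualHahn n a b c).eval (x ^ 2) =
      poch (a + b) n * poch (a + c) n *
        hyp32 (-(n : ℂ)) (a + Complex.I * x) (a - Complex.I * x) (a + b) (a + c) 1 := by
  simp only [continuousDualHahn, hyp32, eval_mul, eval_C, eval_finsetSum, eval_prod, eval_add,
    eval_X]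
  congr 1
  rw [tsum_eq_sum (s := Finset.range (n + 1))]
  · refine Finset.sum_congr rfl fun k _ => ?_
    have h : ∏ j ∈ Finset.range k, ((a + j) ^ 2 + x ^ 2) =
        poch (a + Complex.I * x) k * poch (a - Complex.I * x) k := by
      rw [poch_eq_prod, poch_eq_prod, ← Finset.prod_mul_distrib]
      refine Finset.prod_congr rfl fun j _ => ?_
      linear_combination x ^ 2 * Complex.I_sq
    rw [h]
    ring
  · intro k hk
    rw [poch_neg_eq_zero (by simpa using hk)]
    simp

end

/-! At `x = ia` the parameter `a + ix` is `0` and every series collapses to `1`, so the normalizing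
values are the nonzero prefactors and the normalized polynomials are the bare hypergeometric series.
What remains is the pair of `₂F₁`–`₃F₂` identities. Write `F_m` for the `₂F₁` at `2` with upper
parameter `-m`, and `E_n`, `O_n` for the `₃F₂` with last lower parameter `a`, `a + 1`. The `F_m`
satisfy a three-term recurrence in `m` (`ordinaryHypergeometric_two_recurrence`). Under `F_{2n} =
E_n`, `F_{2n+1} = -(ix/a) O_n`, its even and odd instances become `hyp32_recurrence_even` and
`hyp32_recurrence_odd`, so a joint induction on `n` proves both identities. -/

/-! ### Pochhammer symbols -/

theorem poch_zero (c : ℂ) : poch c 0 = 1 := by simp [poch]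

theorem poch_succ (c : ℂ) (k : ℕ) : poch c (k + 1) = poch c k * (c + k) := by
  simp only [poch, ascPochhammer_succ_eval]

theorem poch_succ_left (c : ℂ) (k : ℕ) : poch c (k + 1) = c * poch (c + 1) k := by
  rw [poch_eq_prod, poch_eq_prod, Finset.prod_range_succ', mul_comm]
  congr 1
  · simp
  · exact Finset.prod_congr rfl fun j _ => by push_cast; ring

theorem mul_poch_add_one (c : ℂ) (k : ℕ) : c * poch (c + 1) k = poch c k * (c + k) := by
  rw [← poch_succ_left, poch_succ]

theorem poch_zero_left_succ (k : ℕ) : poch 0 (k + 1) = 0 := by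
  simp [poch_succ_left]

theorem poch_ne_zero {c : ℂ} (hc : ∀ k : ℕ, c + k ≠ 0) (k : ℕ) : poch c k ≠ 0 := by
  rw [poch_eq_prod]
  exact Finset.prod_ne_zero_iff.2 fun j _ => hc j

/-! ### Terminating series as finite sums, and degenerate parameters -/

/-- The general term of the series `₂F₁(s, b; c; 2)`. -/
noncomputable def hyp21Term (s b c : ℂ) (k : ℕ) : ℂ :=
  poch s k * poch b k / (poch c k * (k.factorial : ℂ)) * 2 ^ k

/-- The general term of the series `₃F₂(s, u, v; b, c; 1)`. -/
noncomputable def hyp32Term (s u v b c : ℂ) (k : ℕ) : ℂ :=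
  poch s k * poch u k * poch v k / (poch b k * poch c k * (k.factorial : ℂ))

theorem ordinaryHypergeometric_eq_sum_range {m N : ℕ} (h : m < N) (b c : ℂ) :
    ordinaryHypergeometric (-(m : ℂ)) b c (2 : ℂ) =
      ∑ k ∈ Finset.range N, hyp21Term (-(m : ℂ)) b c k := by
  rw [ordinaryHypergeometric_eq_tsum]
  simp only
  rw [tsum_eq_sum (s := Finset.range N)]
  · refine Finset.sum_congr rfl fun k _ => ?_
    simp only [hyp21Term, poch, smul_eq_mul, div_eq_mul_inv, mul_inv]
    ring
  · intro k hk
    have h := poch_neg_eq_zero (n := m) (k := k) (h.trans_le (by simpa using hk))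
    rw [poch] at h
    simp [h]

theorem hyp32_eq_sum_range {n N : ℕ} (h : n < N) (u v b c : ℂ) :
    hyp32 (-(n : ℂ)) u v b c 1 = ∑ k ∈ Finset.range N, hyp32Term (-(n : ℂ)) u v b c k := by
  rw [hyp32, tsum_eq_sum (s := Finset.range N)]
  · simp [hyp32Term]
  · intro k hk
    rw [poch_neg_eq_zero (h.trans_le (by simpa using hk))]
    simp

theorem ordinaryHypergeometric_zero_left (b c z : ℂ) :
    ordinaryHypergeometric 0 b c z = 1 := by
  rw [ordinaryHypergeometric_eq_tsum]
  simp only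
  rw [tsum_eq_single 0]
  · simp
  · intro k hk
    obtain ⟨j, rfl⟩ := Nat.exists_eq_succ_of_ne_zero hk
    have h := poch_zero_left_succ j
    rw [poch] at h
    simp [h]

theorem hyp32_eq_one_of_zero_left (u v b c z : ℂ) : hyp32 0 u v b c z = 1 := by
  rw [hyp32, tsum_eq_single 0]
  · simp [poch_zero]
  · intro k hk
    obtain ⟨j, rfl⟩ := Nat.exists_eq_succ_of_ne_zero hk
    simp [poch_zero_left_succ]

theorem ordinaryHypergeometric_zero_middle (s c z : ℂ) :
    ordinaryHypergeometric s 0 c z = 1 := by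
  rw [ordinaryHypergeometric_eq_tsum]
  simp only
  rw [tsum_eq_single 0]
  · simp
  · intro k hk
    obtain ⟨j, rfl⟩ := Nat.exists_eq_succ_of_ne_zero hk
    have h := poch_zero_left_succ j
    rw [poch] at h
    simp [h]

theorem hyp32_eq_one_of_zero_middle (s v b c z : ℂ) : hyp32 s 0 v b c z = 1 := by
  rw [hyp32, tsum_eq_single 0]
  · simp [poch_zero]
  · intro k hk
    obtain ⟨j, rfl⟩ := Nat.exists_eq_succ_of_ne_zero hk
    simp [poch_zero_left_succ]

theorem hyp21Term_zero (s b c : ℂ) : hyp21Term s b c 0 = 1 := by simp [hyp21Term, poch_zero]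

theorem hyp32Term_zero (s u v b c : ℂ) : hyp32Term s u v b c 0 = 1 := by
  simp [hyp32Term, poch_zero]

theorem hyp21Term_neg_eq_zero {m k : ℕ} (h : m < k) (b c : ℂ) :
    hyp21Term (-(m : ℂ)) b c k = 0 := by
  simp [hyp21Term, poch_neg_eq_zero h]

theorem hyp32Term_neg_eq_zero {n k : ℕ} (h : n < k) (u v b c : ℂ) :
    hyp32Term (-(n : ℂ)) u v b c k = 0 := by
  simp [hyp32Term, poch_neg_eq_zero h]

/-! ### Three-term recurrence for the `₂F₁` at `2` -/

/-- Telescoping certificate for the recurrence in `m`: after subtracting the same combination at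
`k`, the `k`-dependent coefficients `2k` cancel. -/
theorem hyp21Term_contiguous_succ {c : ℂ} (hc : ∀ k : ℕ, c + k ≠ 0) (m b : ℂ) (k : ℕ) :
    (2 * ((k + 1 : ℕ) : ℂ) + c) * hyp21Term (-m) b c (k + 1)
        - (c + m) * hyp21Term (-(m + 1)) b c (k + 1) + m * hyp21Term (-(m - 1)) b c (k + 1) =
      2 * (b + k) * hyp21Term (-m) b c k := by
  have e1 : poch (-(m + 1)) (k + 1) = -(m + 1) * poch (-m) k := by
    rw [poch_succ_left]; congr 2; ring
  -- Keeping the factor `m` avoids dividing by it, so `m = 0` needs no exclusion.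
  have e2 : m * poch (-(m - 1)) (k + 1) = (m - k - 1) * (poch (-m) k * (-m + k)) := by
    have h := mul_poch_add_one (-m) (k + 1)
    rw [poch_succ (-m), show -m + 1 = -(m - 1) by ring] at h
    push_cast at h
    linear_combination -h
  have hp := poch_ne_zero hc k
  have hk := hc k
  have hf : (k.factorial : ℂ) ≠ 0 := by exact_mod_cast k.factorial_ne_zero
  have hk1 : (k : ℂ) + 1 ≠ 0 := by exact_mod_cast k.succ_ne_zero
  have e3 : m * hyp21Term (-(m - 1)) b c (k + 1) =
      (m - k - 1) * (poch (-m) k * (-m + k)) * poch b (k + 1) /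
        (poch c (k + 1) * ((k + 1).factorial : ℂ)) * 2 ^ (k + 1) := by
    rw [← e2, hyp21Term]; ring
  rw [e3]
  simp only [hyp21Term, e1, poch_succ, Nat.factorial_succ, pow_succ]
  push_cast
  field_simp
  ring

theorem ordinaryHypergeometric_two_recurrence {c : ℂ} (hc : ∀ k : ℕ, c + k ≠ 0) (m : ℕ) (b : ℂ) :
    (c + (m + 1 : ℕ)) * ordinaryHypergeometric (-((m + 2 : ℕ) : ℂ)) b c (2 : ℂ) =
      (c - 2 * b) * ordinaryHypergeometric (-((m + 1 : ℕ) : ℂ)) b c (2 : ℂ) +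
        (m + 1 : ℕ) * ordinaryHypergeometric (-(m : ℂ)) b c (2 : ℂ) := by
  rw [ordinaryHypergeometric_eq_sum_range (N := m + 3) (by lia),
    ordinaryHypergeometric_eq_sum_range (N := m + 3) (by lia),
    ordinaryHypergeometric_eq_sum_range (N := m + 3) (by lia)]
  -- `W (k + 1) - W k` is the `k`-th term of the recurrence. `W` vanishes at `0` because its
  -- coefficients cancel, and at `m + 3` because all three series have ended.
  let W : ℕ → ℂ := fun k => (2 * (k : ℂ) + c) * hyp21Term (-((m + 1 : ℕ) : ℂ)) b c k
    - (c + (m + 1 : ℕ)) * hyp21Term (-((m + 2 : ℕ) : ℂ)) b c k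
    + (m + 1 : ℕ) * hyp21Term (-(m : ℂ)) b c k
  have hW : ∀ k, W (k + 1) = 2 * (b + k) * hyp21Term (-((m + 1 : ℕ) : ℂ)) b c k := fun k => by
    rw [← hyp21Term_contiguous_succ hc]
    simp only [W]
    congr 5 <;> push_cast <;> ring
  have hsum := Finset.sum_range_sub W (m + 3)
  have h0 : W 0 = 0 := by simp [W, hyp21Term_zero]
  have hN : W (m + 3) = 0 := by
    simp only [W]
    rw [hyp21Term_neg_eq_zero (by lia), hyp21Term_neg_eq_zero (by lia),
      hyp21Term_neg_eq_zero (by lia)]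
    ring
  rw [h0, hN, sub_zero] at hsum
  rw [← sub_eq_zero, ← hsum, Finset.mul_sum, Finset.mul_sum, Finset.mul_sum,
    ← Finset.sum_add_distrib, ← Finset.sum_sub_distrib]
  refine Finset.sum_congr rfl fun k _ => ?_
  rw [hW]
  simp only [W]
  ring

/-! ### Interleaved recurrences for the `₃F₂` at `1` -/

/-- No telescoping is needed: since `(a)_k / (a+1)_k = a / (a+k)` and `(n+1) (-n)_k = (n+1-k)
(-n-1)_k`, the relation holds term by term. -/
theorem hyp32_recurrence_odd {a : ℂ} (ha : ∀ k : ℕ, a + k ≠ 0) (n : ℕ) (u v b : ℂ) :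
    (a + (n + 1 : ℕ)) * hyp32 (-((n + 1 : ℕ) : ℂ)) u v b (a + 1) 1 =
      a * hyp32 (-((n + 1 : ℕ) : ℂ)) u v b a 1 +
        (n + 1 : ℕ) * hyp32 (-(n : ℂ)) u v b (a + 1) 1 := by
  rw [hyp32_eq_sum_range (N := n + 2) (by lia), hyp32_eq_sum_range (N := n + 2) (by lia),
    hyp32_eq_sum_range (N := n + 2) (by lia), Finset.mul_sum, Finset.mul_sum, Finset.mul_sum,
    ← Finset.sum_add_distrib]
  refine Finset.sum_congr rfl fun k _ => ?_
  have e1 : ((n + 1 : ℕ) : ℂ) * poch (-(n : ℂ)) k =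
      poch (-((n + 1 : ℕ) : ℂ)) k * ((n + 1 : ℕ) - k) := by
    have h := mul_poch_add_one (-((n + 1 : ℕ) : ℂ)) k
    rw [show -((n + 1 : ℕ) : ℂ) + 1 = -(n : ℂ) by push_cast; ring] at h
    linear_combination -h
  have e2 : poch (a + 1) k = poch a k * (a + k) / a := by
    have h0 : a ≠ 0 := by simpa using ha 0
    rw [← mul_poch_add_one]; field_simp
  have e3 : ((n + 1 : ℕ) : ℂ) * hyp32Term (-(n : ℂ)) u v b (a + 1) k =
      poch (-((n + 1 : ℕ) : ℂ)) k * ((n + 1 : ℕ) - k) * poch u k * poch v k /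
        (poch b k * poch (a + 1) k * (k.factorial : ℂ)) := by
    rw [← e1, hyp32Term]; ring
  have hp := poch_ne_zero ha k
  have hk := ha k
  have h0 : a ≠ 0 := by simpa using ha 0
  rw [e3]
  simp only [hyp32Term, e2]
  field_simp
  ring

/-- Telescoping certificate for `hyp32_recurrence_even`: on taking differences in `k` the squares
`(a + k) ^ 2` cancel and only `x ^ 2` survives. -/
theorem hyp32Term_contiguous_succ {a : ℂ} (ha : ∀ k : ℕ, a + k ≠ 0)
    (hb : ∀ k : ℕ, a + 1 / 2 + k ≠ 0) (n x : ℂ) (k : ℕ) :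
    2 / a * (a + (k + 1 : ℕ)) ^ 2 *
          hyp32Term (-n) (a + Complex.I * x) (a - Complex.I * x) (a + 1 / 2) (a + 1) (k + 1)
        - (2 * a + 2 * n + 1) *
          hyp32Term (-(n + 1)) (a + Complex.I * x) (a - Complex.I * x) (a + 1 / 2) a (k + 1)
        + (2 * n + 1) *
          hyp32Term (-n) (a + Complex.I * x) (a - Complex.I * x) (a + 1 / 2) a (k + 1) =
      2 / a * ((a + k) ^ 2 + x ^ 2) *
        hyp32Term (-n) (a + Complex.I * x) (a - Complex.I * x) (a + 1 / 2) (a + 1) k := by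
  have h0 : a ≠ 0 := by simpa using ha 0
  have e1 : poch (-(n + 1)) (k + 1) = -(n + 1) * poch (-n) k := by
    rw [poch_succ_left]; congr 2; ring
  have e2 : ∀ k, poch (a + 1) k = poch a k * (a + k) / a := fun k => by
    rw [← mul_poch_add_one]; field_simp
  have e3 : (a + k) ^ 2 + x ^ 2 = (a + Complex.I * x + k) * (a - Complex.I * x + k) := by
    linear_combination x ^ 2 * Complex.I_sq
  have hp := poch_ne_zero ha k
  have hq := poch_ne_zero hb k
  have hk := ha k
  have hk' := ha (k + 1)
  have hbk := hb k
  have hf : (k.factorial : ℂ) ≠ 0 := by exact_mod_cast k.factorial_ne_zero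
  have hk1 : (k : ℂ) + 1 ≠ 0 := by exact_mod_cast k.succ_ne_zero
  rw [e3]
  simp only [hyp32Term, e1, e2, poch_succ, Nat.factorial_succ]
  generalize poch (a + 1 / 2) k = Q at *
  generalize a + Complex.I * x + k = U
  generalize a - Complex.I * x + k = V
  have hB : a + 1 / 2 + (k : ℂ) = (2 * a + 1 + 2 * k) / 2 := by ring
  have hB0 : 2 * a + 1 + 2 * (k : ℂ) ≠ 0 := by
    intro h; apply hbk; rw [hB, h]; simp
  rw [hB]
  push_cast at hk' ⊢
  field_simp
  ring

theorem hyp32_recurrence_even {a : ℂ} (ha : ∀ k : ℕ, a + k ≠ 0)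
    (hb : ∀ k : ℕ, a + 1 / 2 + k ≠ 0) (n : ℕ) (x : ℂ) :
    (2 * a + 2 * n + 1) *
        hyp32 (-((n + 1 : ℕ) : ℂ)) (a + Complex.I * x) (a - Complex.I * x) (a + 1 / 2) a 1 =
      -(2 / a * x ^ 2) *
          hyp32 (-(n : ℂ)) (a + Complex.I * x) (a - Complex.I * x) (a + 1 / 2) (a + 1) 1 +
        (2 * n + 1) *
          hyp32 (-(n : ℂ)) (a + Complex.I * x) (a - Complex.I * x) (a + 1 / 2) a 1 := by
  have h0 : a ≠ 0 := by simpa using ha 0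
  rw [hyp32_eq_sum_range (N := n + 2) (by lia), hyp32_eq_sum_range (N := n + 2) (by lia),
    hyp32_eq_sum_range (N := n + 2) (by lia)]
  let W : ℕ → ℂ := fun k => 2 / a * (a + k) ^ 2 *
      hyp32Term (-(n : ℂ)) (a + Complex.I * x) (a - Complex.I * x) (a + 1 / 2) (a + 1) k
    - (2 * a + 2 * n + 1) *
      hyp32Term (-((n + 1 : ℕ) : ℂ)) (a + Complex.I * x) (a - Complex.I * x) (a + 1 / 2) a k
    + (2 * n + 1) *
      hyp32Term (-(n : ℂ)) (a + Complex.I * x) (a - Complex.I * x) (a + 1 / 2) a k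
  have hW : ∀ k, W (k + 1) = 2 / a * ((a + k) ^ 2 + x ^ 2) *
      hyp32Term (-(n : ℂ)) (a + Complex.I * x) (a - Complex.I * x) (a + 1 / 2) (a + 1) k :=
    fun k => by
      rw [← hyp32Term_contiguous_succ ha hb]
      simp only [W, Nat.cast_add, Nat.cast_one]
  have hsum := Finset.sum_range_sub W (n + 2)
  have hW0 : W 0 = 0 := by
    simp only [W, hyp32Term_zero, Nat.cast_zero]
    field_simp
    ring
  have hN : W (n + 2) = 0 := by
    simp only [W]
    rw [hyp32Term_neg_eq_zero (by lia), hyp32Term_neg_eq_zero (by lia),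
      hyp32Term_neg_eq_zero (by lia)]
    ring
  rw [hW0, hN, sub_zero] at hsum
  rw [← sub_eq_zero, ← hsum, Finset.mul_sum, Finset.mul_sum, Finset.mul_sum,
    ← Finset.sum_add_distrib, ← Finset.sum_sub_distrib]
  refine Finset.sum_congr rfl fun k _ => ?_
  rw [hW]
  simp only [W]
  ring

/-! ### Induction for the hypergeometric identities -/

/-- The quadratic transformations of the terminating `₂F₁` at `2`, in even and in odd degree. -/
theorem ordinaryHypergeometric_two_eq_hyp32 {a : ℂ} (ha : ∀ k : ℕ, 2 * a + k ≠ 0) (n : ℕ)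
    (x : ℂ) :
    ordinaryHypergeometric (-((2 * n : ℕ) : ℂ)) (a + Complex.I * x) (2 * a) (2 : ℂ) =
        hyp32 (-(n : ℂ)) (a + Complex.I * x) (a - Complex.I * x) (a + 1 / 2) a 1 ∧
      ordinaryHypergeometric (-((2 * n + 1 : ℕ) : ℂ)) (a + Complex.I * x) (2 * a) (2 : ℂ) =
        x / (Complex.I * a) *
          hyp32 (-(n : ℂ)) (a + Complex.I * x) (a - Complex.I * x) (a + 1 / 2) (a + 1) 1 := by
  have ha' : ∀ k : ℕ, a + k ≠ 0 := fun k h => ha (2 * k) (by push_cast; linear_combination 2 * h)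
  have hb : ∀ k : ℕ, a + 1 / 2 + k ≠ 0 := fun k h =>
    ha (2 * k + 1) (by push_cast; linear_combination 2 * h)
  have h0 : a ≠ 0 := by simpa using ha' 0
  have hI : x / (Complex.I * a) = -(Complex.I * x) / a := by
    field_simp
    linear_combination x * Complex.I_sq
  rw [hI]
  induction n with
  | zero =>
    constructor
    · simp [ordinaryHypergeometric_zero_left, hyp32_eq_one_of_zero_left]
    · rw [ordinaryHypergeometric_eq_sum_range (N := 2) (by lia), Finset.sum_range_succ,
        Finset.sum_range_one, hyp21Term_zero]
      simp only [hyp21Term, poch_succ, poch_zero]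
      simp [hyp32_eq_one_of_zero_left]
      field_simp
      ring
  | succ n ih =>
    obtain ⟨ihE, ihO⟩ := ih
    have r1 := ordinaryHypergeometric_two_recurrence ha (2 * n) (a + Complex.I * x)
    have r2 := ordinaryHypergeometric_two_recurrence ha (2 * n + 1) (a + Complex.I * x)
    have s1 := hyp32_recurrence_even ha' hb n x
    have s2 := hyp32_recurrence_odd ha' n (a + Complex.I * x) (a - Complex.I * x) (a + 1 / 2)
    have hE : ordinaryHypergeometric (-((2 * n + 2 : ℕ) : ℂ)) (a + Complex.I * x) (2 * a)
        (2 : ℂ) = hyp32 (-((n + 1 : ℕ) : ℂ)) (a + Complex.I * x) (a - Complex.I * x)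
          (a + 1 / 2) a 1 := by
      -- Here `c - 2b = -2ix` multiplies `F_{2n+1} = -(ix/a) O_n`, which gives the `-(2/a) x ^ 2` of
      -- `s1`.
      apply mul_left_cancel₀ (ha (2 * n + 1))
      rw [r1, ihE, ihO]
      push_cast at s1 ⊢
      linear_combination -s1 + 2 * x ^ 2 / a *
        hyp32 (-(n : ℂ)) (a + Complex.I * x) (a - Complex.I * x) (a + 1 / 2) (a + 1) 1 *
          Complex.I_sq
    refine ⟨hE, ?_⟩
    -- `r2` is `s2` scaled by `-2ix/a`.
    apply mul_left_cancel₀ (ha (2 * n + 1 + 1))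
    rw [show 2 * (n + 1) + 1 = 2 * n + 1 + 2 by ring, r2, hE, ihO]
    push_cast at s2 ⊢
    linear_combination 2 * Complex.I * x / a * s2 + 2 * Complex.I * x *
      hyp32 (-((n : ℂ) + 1)) (a + Complex.I * x) (a - Complex.I * x) (a + 1 / 2) a 1 *
        mul_inv_cancel₀ h0

/-! ### Normalization at `x = ia` and the main theorem -/

theorem one_sub_exp_neg_two_I_mul_pi_div_two :
    1 - Complex.exp (-(2 * Complex.I * ((Real.pi / 2 : ℝ) : ℂ))) = 2 := by
  rw [show -(2 * Complex.I * ((Real.pi / 2 : ℝ) : ℂ)) = -(Real.pi * Complex.I) by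
    push_cast; ring, Complex.exp_neg, Complex.exp_pi_mul_I]
  norm_num

theorem meixnerPollaczek_pi_div_two_eval (m : ℕ) (a x : ℂ) :
    (meixnerPollaczek m a (Real.pi / 2)).eval x =
      (meixnerPollaczek m a (Real.pi / 2)).eval (Complex.I * a) *
        ordinaryHypergeometric (-(m : ℂ)) (a + Complex.I * x) (2 * a) (2 : ℂ) := by
  have h : a + Complex.I * (Complex.I * a) = 0 := by linear_combination a * Complex.I_sq
  rw [meixnerPollaczek_eval, meixnerPollaczek_eval, one_sub_exp_neg_two_I_mul_pi_div_two, h,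
    ordinaryHypergeometric_zero_middle, mul_one]

theorem meixnerPollaczek_pi_div_two_eval_ne_zero {a : ℂ} (ha : ∀ k : ℕ, 2 * a + k ≠ 0) (m : ℕ) :
    (meixnerPollaczek m a (Real.pi / 2)).eval (Complex.I * a) ≠ 0 := by
  have h : a + Complex.I * (Complex.I * a) = 0 := by linear_combination a * Complex.I_sq
  have hf : (m.factorial : ℂ) ≠ 0 := by exact_mod_cast m.factorial_ne_zero
  rw [meixnerPollaczek_eval, h, ordinaryHypergeometric_zero_middle, mul_one]
  exact mul_ne_zero (div_ne_zero (poch_ne_zero ha m) hf) (Complex.exp_ne_zero _)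

theorem continuousDualHahn_eval_neg_sq (n : ℕ) (a b c : ℂ) :
    (continuousDualHahn n a b c).eval (-(a ^ 2)) = poch (a + b) n * poch (a + c) n := by
  have h : a + Complex.I * (Complex.I * a) = 0 := by linear_combination a * Complex.I_sq
  rw [show -(a ^ 2) = (Complex.I * a) ^ 2 by linear_combination -(a ^ 2) * Complex.I_sq,
    continuousDualHahn_eval_sq, h, hyp32_eq_one_of_zero_middle, mul_one]

theorem mainTheorem11 (a : ℂ) (ha : ∀ k : ℕ, 2 * a ≠ -(k : ℂ)) (n : ℕ) :
    -- the normalizing values do not vanish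
    ((meixnerPollaczek (2 * n) a (Real.pi / 2)).eval (Complex.I * a) ≠ 0 ∧
      (meixnerPollaczek (2 * n + 1) a (Real.pi / 2)).eval (Complex.I * a) ≠ 0 ∧
      (continuousDualHahn n a (1 / 2) 0).eval (-(a ^ 2)) ≠ 0 ∧
      Complex.I * a * (continuousDualHahn n a (1 / 2) 1).eval (-(a ^ 2)) ≠ 0) ∧
    ∀ x : ℂ,
      -- the quadratic transformation in even degree
      ((meixnerPollaczek (2 * n) a (Real.pi / 2)).eval x /
          (meixnerPollaczek (2 * n) a (Real.pi / 2)).eval (Complex.I * a) =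
        (continuousDualHahn n a (1 / 2) 0).eval (x ^ 2) /
          (continuousDualHahn n a (1 / 2) 0).eval (-(a ^ 2))) ∧
      -- the quadratic transformation in odd degree
      ((meixnerPollaczek (2 * n + 1) a (Real.pi / 2)).eval x /
          (meixnerPollaczek (2 * n + 1) a (Real.pi / 2)).eval (Complex.I * a) =
        x * (continuousDualHahn n a (1 / 2) 1).eval (x ^ 2) /
          (Complex.I * a * (continuousDualHahn n a (1 / 2) 1).eval (-(a ^ 2)))) ∧
      -- the sides of the two transformations are the following hypergeometric expressions
      ((meixnerPollaczek (2 * n) a (Real.pi / 2)).eval x /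
          (meixnerPollaczek (2 * n) a (Real.pi / 2)).eval (Complex.I * a) =
        ordinaryHypergeometric (-(2 * n : ℂ)) (a + Complex.I * x) (2 * a) (2 : ℂ)) ∧
      ((continuousDualHahn n a (1 / 2) 0).eval (x ^ 2) /
          (continuousDualHahn n a (1 / 2) 0).eval (-(a ^ 2)) =
        hyp32 (-(n : ℂ)) (a + Complex.I * x) (a - Complex.I * x) (a + 1 / 2) a 1) ∧
      ((meixnerPollaczek (2 * n + 1) a (Real.pi / 2)).eval x /
          (meixnerPollaczek (2 * n + 1) a (Real.pi / 2)).eval (Complex.I * a) =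
        ordinaryHypergeometric (-(2 * n + 1 : ℂ)) (a + Complex.I * x) (2 * a) (2 : ℂ)) ∧
      (x * (continuousDualHahn n a (1 / 2) 1).eval (x ^ 2) /
          (Complex.I * a * (continuousDualHahn n a (1 / 2) 1).eval (-(a ^ 2))) =
        x / (Complex.I * a) *
          hyp32 (-(n : ℂ)) (a + Complex.I * x) (a - Complex.I * x) (a + 1 / 2) (a + 1) 1) ∧
      -- the terminating hypergeometric identities
      (ordinaryHypergeometric (-(2 * n : ℂ)) (a + Complex.I * x) (2 * a) (2 : ℂ) =
        hyp32 (-(n : ℂ)) (a + Complex.I * x) (a - Complex.I * x) (a + 1 / 2) a 1) ∧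
      (ordinaryHypergeometric (-(2 * n + 1 : ℂ)) (a + Complex.I * x) (2 * a) (2 : ℂ) =
        x / (Complex.I * a) *
          hyp32 (-(n : ℂ)) (a + Complex.I * x) (a - Complex.I * x) (a + 1 / 2) (a + 1) 1) := by
  have ha2 : ∀ k : ℕ, 2 * a + k ≠ 0 := fun k h => ha k (eq_neg_of_add_eq_zero_left h)
  have ha' : ∀ k : ℕ, a + k ≠ 0 := fun k h =>
    ha2 (2 * k) (by push_cast; linear_combination 2 * h)
  have hb : ∀ k : ℕ, a + 1 / 2 + k ≠ 0 := fun k h =>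
    ha2 (2 * k + 1) (by push_cast; linear_combination 2 * h)
  have ha1 : ∀ k : ℕ, a + 1 + k ≠ 0 := fun k h =>
    ha' (k + 1) (by push_cast; linear_combination h)
  have h0 : Complex.I * a ≠ 0 := mul_ne_zero Complex.I_ne_zero (by simpa using ha' 0)
  have hPe := meixnerPollaczek_pi_div_two_eval_ne_zero ha2 (2 * n)
  have hPo := meixnerPollaczek_pi_div_two_eval_ne_zero ha2 (2 * n + 1)
  have hSe : (continuousDualHahn n a (1 / 2) 0).eval (-(a ^ 2)) ≠ 0 := by
    rw [continuousDualHahn_eval_neg_sq, add_zero]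
    exact mul_ne_zero (poch_ne_zero hb n) (poch_ne_zero ha' n)
  have hSo : (continuousDualHahn n a (1 / 2) 1).eval (-(a ^ 2)) ≠ 0 := by
    rw [continuousDualHahn_eval_neg_sq]
    exact mul_ne_zero (poch_ne_zero hb n) (poch_ne_zero ha1 n)
  refine ⟨⟨hPe, hPo, hSe, mul_ne_zero h0 hSo⟩, fun x => ?_⟩
  obtain ⟨hE, hO⟩ := ordinaryHypergeometric_two_eq_hyp32 ha2 n x
  have lE := meixnerPollaczek_pi_div_two_eval (2 * n) a x
  have lO := meixnerPollaczek_pi_div_two_eval (2 * n + 1) a x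
  push_cast at hE hO lE lO
  rw [← mul_comm (ordinaryHypergeometric _ _ _ _), ← div_eq_iff hPe] at lE
  rw [← mul_comm (ordinaryHypergeometric _ _ _ _), ← div_eq_iff hPo] at lO
  have rE : (continuousDualHahn n a (1 / 2) 0).eval (x ^ 2) /
      (continuousDualHahn n a (1 / 2) 0).eval (-(a ^ 2)) =
        hyp32 (-(n : ℂ)) (a + Complex.I * x) (a - Complex.I * x) (a + 1 / 2) a 1 := by
    rw [div_eq_iff hSe, continuousDualHahn_eval_sq, continuousDualHahn_eval_neg_sq, add_zero]
    ring
  have rO : x * (continuousDualHahn n a (1 / 2) 1).eval (x ^ 2) /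
      (Complex.I * a * (continuousDualHahn n a (1 / 2) 1).eval (-(a ^ 2))) =
        x / (Complex.I * a) *
          hyp32 (-(n : ℂ)) (a + Complex.I * x) (a - Complex.I * x) (a + 1 / 2) (a + 1) 1 := by
    rw [mul_div_mul_comm]
    congr 1
    rw [div_eq_iff hSo, continuousDualHahn_eval_sq, continuousDualHahn_eval_neg_sq]
    ring
  exact ⟨by rw [lE, rE, hE], by rw [lO, rO, hO], lE, rE, lO, rO, hE, hO⟩
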